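/- Let $M>1$ and let $H_1,\dots,H_M$ be Hamiltonians (Hermitian operators) on a complex Hilbert space of finite dimension at least $2$. Let $E_0^k\le E_1^k\le\cdots$ be the eigenvalues of $H_k$ with multiplicity, and $\psi_0^k,\psi_1^k,\dots$ a corresponding orthonormal eigenbasis, with the phases of the ground states chosen such that $\langle\psi_0^{k+1}|\psi_0^k\rangle\ge 0$ for $1\le k<M$. Let $\gamma=\min_{1\le k\le M}(E_1^k-E_0^k)$ and $\lambda=\max_{2\le k\le M}\|H_k-H_{k-1}\|$, and suppose $\gamma>0$. Let $\Delta t\in\mathbb{R}$, $U_k=e^{-iH_k\Delta t}$, $P_k=|\psi_0^k\rangle\langle\psi_0^k|$, and let $U_{k,\mathrm{ad}}=\sum_\ell e^{-iE_\ell^k\Delta t}|\psi_\ell^{k+1}\rangle\langle\psi_\ell^k|$ for $k<M$ and $U_{M,\mathrm{ad}}=U_M$ be the adiabatic unitaries. Say that an operator $W$ accumulates the phase $\varphi$ if $W\psi_0^1=re^{-i\varphi}\psi_0^M$ with $r>0$. Let $0<\epsilon<1$ and suppose $$\frac{\lambda}{\gamma}<\sqrt{1-\exp\left(\frac{\log(1-\epsilon)}{M-1}\right)}.$$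 (1) Failure probability. For a system prepared in $\psi_0^1$, the probability $1-\|U_MP_M\cdots U_1P_1\psi_0^1\|^2$ that it leaves the ground state in one of the $M$ repetitions is at most $\epsilon$. (2) The ideal sequence $U_{M,\mathrm{ad}}P_M\cdots U_{1,\mathrm{ad}}P_1$ accumulates the phase $\sum_{k=1}^M E_0^k\Delta t$, and so does the sequence $U_MP_M\cdots U_1P_1$ in which the system stays in the ground state. (3) If $\gamma\ne2\lambda$, then $$\left\|U_MP_M\cdots U_1P_1-U_{M,\mathrm{ad}}P_M\cdots U_{1,\mathrm{ad}}P_1\right\|\le\frac{2M\lambda^2}{(\gamma-2\lambda)^2}.$$ (4) More generally, allow the system to leave the ground state for at most one repetition at a time: let $$W=\sum_S U_MR_M^S\cdots U_1R_1^S,$$ where $S$ runs over the subsets of $\{1,\dots,M-1\}$ without two consecutive elements, $R_k^S=1-P_k$ for $k\in S$, and $R_k^S=P_k$ for $k\notin S$. If $\gamma\neq 2\lambda$, then every phase $\phi_{est}$ accumulated by $W$ and every phase $\phi_{true}$ accumulated by the ideal sequence satisfy, modulo $2\pi$, $$|\phi_{est}-\phi_{true}|\le\frac{2M\lambda^2}{(\gamma-2\lambda)^2},$$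 and $W$ does accumulate a phase whenever this bound is less than $\pi$. -/

import Mathlib

open scoped InnerProductSpace ComplexOrder

noncomputable section

namespace RandomizedPhaseEstimation

variable {E : Type*} [NormedAddCommGroup E] [InnerProductSpace ℂ E] [FiniteDimensional ℂ E]

/-- A Hamiltonian on a finite-dimensional complex inner product space: a symmetric operator. -/
abbrev Hamiltonian (E : Type*) [NormedAddCommGroup E] [InnerProductSpace ℂ E] : Type _ :=
  {A : E →L[ℂ] E // (A : E →ₗ[ℂ] E).IsSymmetric}

/-- The energies `E_0 ≤ E_1 ≤ ⋯` of a Hamiltonian, in increasing order and with multiplicity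
(Mathlib lists the eigenvalues in decreasing order, hence the reversal of the index).
The dimension is written as `d + 2`, so that `E_0` and `E_1` both exist. -/
def energy {d : ℕ} (hd : Module.finrank ℂ E = d + 2) (A : Hamiltonian E) (l : Fin (d + 2)) : ℝ :=
  A.2.eigenvalues hd (Fin.rev l)

/-- The gap `E_1 - E_0` between the ground and the first excited energy. -/
def gap {d : ℕ} (hd : Module.finrank ℂ E = d + 2) (A : Hamiltonian E) : ℝ :=
  energy hd A 1 - energy hd A 0

/-- `b` is an orthonormal eigenbasis of `A`, enumerated by increasing energy. -/
def IsEigenbasis {d : ℕ} (hd : Module.finrank ℂ E = d + 2) (A : Hamiltonian E)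
    (b : OrthonormalBasis (Fin (d + 2)) ℂ E) : Prop :=
  ∀ l, A.1 (b l) = (energy hd A l : ℂ) • b l

/-- The time evolution `U = exp(-i A t)`. -/
def evolution (A : Hamiltonian E) (t : ℝ) : E →L[ℂ] E :=
  NormedSpace.exp ((-(Complex.I * (t : ℂ))) • A.1)

/-- The adiabatic unitary `∑ l, |b' l⟩⟨b l| e^{-i E_l t}`, where `b` is an eigenbasis of `A` and
`b'` is an eigenbasis of the next Hamiltonian. -/
def adiabatic {d : ℕ} (hd : Module.finrank ℂ E = d + 2) (A : Hamiltonian E)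
    (b b' : OrthonormalBasis (Fin (d + 2)) ℂ E) (t : ℝ) : E →L[ℂ] E :=
  ∑ l, Complex.exp (-(Complex.I * (energy hd A l : ℂ) * (t : ℂ))) •
    InnerProductSpace.rankOne ℂ (b' l) (b l)

/-- The projector `|b 0⟩⟨b 0|` onto the ground state. -/
def groundProj {d : ℕ} (b : OrthonormalBasis (Fin (d + 2)) ℂ E) : E →L[ℂ] E :=
  InnerProductSpace.rankOne ℂ (b 0) (b 0)

/-- The sequence of evolutions in which the system is in the ground state in every repetition:
`U_n P_n ⋯ U_1 P_1`, with `P_k` the projector onto the ground state of `H k`. -/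
def groundRun {d : ℕ} (H : ℕ → Hamiltonian E) (b : ℕ → OrthonormalBasis (Fin (d + 2)) ℂ E)
    (t : ℝ) : ℕ → (E →L[ℂ] E)
  | 0 => 1
  | n + 1 => evolution (H (n + 1)) t * groundProj (b (n + 1)) * groundRun H b t n

/-- `Uad_n P_n ⋯ Uad_1 P_1`, where `Uad_k` is the adiabatic unitary from `H k` to `H (k + 1)`. -/
def adiabaticSteps {d : ℕ} (hd : Module.finrank ℂ E = d + 2) (H : ℕ → Hamiltonian E)
    (b : ℕ → OrthonormalBasis (Fin (d + 2)) ℂ E) (t : ℝ) : ℕ → (E →L[ℂ] E)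
  | 0 => 1
  | n + 1 => adiabatic hd (H (n + 1)) (b (n + 1)) (b (n + 2)) t * groundProj (b (n + 1)) *
      adiabaticSteps hd H b t n

/-- The ideal (adiabatic) sequence for `n` Hamiltonians. After the last of them there is no
further Hamiltonian to map to, so the last step only evolves under it (taking the same basis twice
gives `∑ l, |b l⟩⟨b l| e^{-i E_l t} = U_n`). -/
def idealRun {d : ℕ} (hd : Module.finrank ℂ E = d + 2) (H : ℕ → Hamiltonian E)
    (b : ℕ → OrthonormalBasis (Fin (d + 2)) ℂ E) (t : ℝ) : ℕ → (E →L[ℂ] E)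
  | 0 => 1
  | n + 1 => adiabatic hd (H (n + 1)) (b (n + 1)) (b (n + 1)) t * groundProj (b (n + 1)) *
      adiabaticSteps hd H b t n

/-- The sequence of evolutions in which the system leaves the ground state for at most one
repetition at a time. In repetition `k` it is in the ground state of `H k` (projector `P_k`) or
not (projector `1 - P_k`), and the coherent sum is over all histories of `n` repetitions that are
not out of the ground state in two consecutive ones. The first component collects the histories
which are in the ground state in repetition `n`, the second one the others. -/
def briefRun {d : ℕ} (H : ℕ → Hamiltonian E) (b : ℕ → OrthonormalBasis (Fin (d + 2)) ℂ E)
    (t : ℝ) : ℕ → (E →L[ℂ] E) × (E →L[ℂ] E)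
  | 0 => (1, 0)
  | n + 1 =>
    (evolution (H (n + 1)) t * groundProj (b (n + 1)) *
        ((briefRun H b t n).1 + (briefRun H b t n).2),
      evolution (H (n + 1)) t * (1 - groundProj (b (n + 1))) * (briefRun H b t n).1)

/-- The operator `W` takes `x` to `y` with phase `φ`: `W x = r e^{-iφ} y` with `r > 0`. -/
def AccumulatesPhase (W : E →L[ℂ] E) (x y : E) (φ : ℝ) : Prop :=
  ∃ r : ℝ, 0 < r ∧ W x = ((r : ℂ) * Complex.exp (-(Complex.I * (φ : ℂ)))) • y

/-- The probability that the system, prepared in the ground state of `H 1`, is found outside the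
ground state of `H k` in one of the repetitions `k = 1, …, M` (Born rule). -/
def failureProb {d : ℕ} (H : ℕ → Hamiltonian E) (b : ℕ → OrthonormalBasis (Fin (d + 2)) ℂ E)
    (t : ℝ) (M : ℕ) : ℝ :=
  1 - ‖groundRun H b t M (b 1 0)‖ ^ 2

end RandomizedPhaseEstimation

end

namespace RandomizedPhaseEstimation

section Evolution

variable {E : Type*} [NormedAddCommGroup E] [InnerProductSpace ℂ E] [FiniteDimensional ℂ E]

/-! Everything depends on `x = lam / γ`, through a sin θ bound for neighbouring ground states:
`infidelity_le` gives infidelity at most `x ^ 2`. The ideal and the ground-state sequences are rank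
one with the same dynamical phase. They differ only by the product `c` of the overlaps, which are
nonnegative by the phase convention. So `c > 0` settles the phases, `c ^ 2 ≥ (1 - x ^ 2) ^ (M - 1)`
the failure probability, and Bernoulli's inequality for `1 - c` the operator norm. For brief
excursions, `briefRun_polar` tracks the ground amplitude: leaving and returning each cost a factor
`x`, so one repetition turns its phase by at most `x ^ 2 / (1 - 2 * x) ^ 2`. This needs `3 * x ≤ 1`;
for larger `x` the claimed bound is at least `π`, hence trivial modulo `2π`. -/

lemma exp_apply_of_eigenvector {T : E →L[ℂ] E} {v : E} {z : ℂ} (h : T v = z • v) :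
    NormedSpace.exp T v = Complex.exp z • v := by
  have hpow : ∀ n : ℕ, (T ^ n) v = z ^ n • v := by
    intro n
    induction n with
    | zero => simp
    | succ n ih => rw [pow_succ, mul_apply_eq_comp, h, map_smul, ih, smul_smul, pow_succ,
        mul_comm]
  have h1 := (NormedSpace.exp_series_hasSum_exp' (𝕂 := ℂ) T).mapL
    (ContinuousLinearMap.apply ℂ E v)
  have h2 := (NormedSpace.exp_series_hasSum_exp' (𝕂 := ℂ) z).smul_const v
  rw [← Complex.exp_eq_exp_ℂ] at h2
  refine h1.unique ?_
  convert! h2 using 2 with n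
  simp [hpow, smul_smul]

lemma evolution_apply_of_eigenvector (A : Hamiltonian E) (t : ℝ) {v : E} {e : ℝ}
    (h : A.1 v = (e : ℂ) • v) :
    evolution A t v = Complex.exp (-(Complex.I * ((e * t : ℝ) : ℂ))) • v := by
  refine exp_apply_of_eigenvector ?_
  rw [smul_apply, h, smul_smul]
  congr 1
  push_cast
  ring

lemma evolution_mem_unitary (A : Hamiltonian E) (t : ℝ) :
    evolution A t ∈ unitary (E →L[ℂ] E) := by
  let _ : NormedAlgebra ℚ (E →L[ℂ] E) := NormedAlgebra.restrictScalars ℚ ℂ _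
  have hA : IsSelfAdjoint A.1 := A.2.isSelfAdjoint
  refine NormedSpace.exp_mem_unitary_of_mem_skewAdjoint ?_
  rw [skewAdjoint.mem_iff, star_smul, hA.star_eq, ← neg_smul]
  simp

lemma inner_evolution (A : Hamiltonian E) (t : ℝ) (x y : E) :
    ⟪evolution A t x, evolution A t y⟫_ℂ = ⟪x, y⟫_ℂ :=
  ContinuousLinearMap.inner_map_map_of_mem_unitary (evolution_mem_unitary A t) x y

lemma norm_evolution (A : Hamiltonian E) (t : ℝ) (x : E) : ‖evolution A t x‖ = ‖x‖ :=
  ContinuousLinearMap.norm_map_of_mem_unitary (evolution_mem_unitary A t) x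

/-- The evolution preserves inner products and only multiplies `v` by a nonzero scalar. -/
lemma inner_evolution_eq_zero_of_eigenvector (A : Hamiltonian E) (t : ℝ) {v w : E} {e : ℝ}
    (h : A.1 v = (e : ℂ) • v) (hvw : ⟪v, w⟫_ℂ = 0) : ⟪v, evolution A t w⟫_ℂ = 0 := by
  have key := inner_evolution A t v w
  rw [evolution_apply_of_eigenvector A t h, inner_smul_left, hvw] at key
  simpa [Complex.exp_ne_zero] using key

/-! ### Perturbation of ground states -/

section

variable {d : ℕ} {hd : Module.finrank ℂ E = d + 2}

lemma energy_mono (A : Hamiltonian E) : Monotone (energy hd A) := fun _ _ h =>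
  A.2.eigenvalues_antitone hd (Fin.rev_le_rev.2 h)

lemma energy_zero_add_gap_le (A : Hamiltonian E) {l : Fin (d + 2)} (hl : l ≠ 0) :
    energy hd A 0 + gap hd A ≤ energy hd A l := by
  have := energy_mono (hd := hd) A (Fin.one_le_of_ne_zero hl)
  unfold gap
  linarith

/-- A one-sided `sin θ` bound: the ground state of the Hamiltonian of lower ground energy is close
to the ground state of the other one. -/
lemma gap_sq_mul_infidelity_le_of_energy_le {A A' : Hamiltonian E}
    {b b' : OrthonormalBasis (Fin (d + 2)) ℂ E} (hb : IsEigenbasis hd A b)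
    (hb' : IsEigenbasis hd A' b') {γ : ℝ} (hγ : 0 ≤ γ) (hgap : γ ≤ gap hd A')
    (hle : energy hd A 0 ≤ energy hd A' 0) :
    γ ^ 2 * (1 - ‖⟪b' 0, b 0⟫_ℂ‖ ^ 2) ≤ ‖A'.1 - A.1‖ ^ 2 := by
  -- For `l ≠ 0` the factor is at least `γ`, because `energy hd A 0 ≤ energy hd A' 0`; the term `l =
  -- 0` is dropped.
  have hcomp : ∀ l, ⟪b' l, (A'.1 - A.1) (b 0)⟫_ℂ =
      ((energy hd A' l - energy hd A 0 : ℝ) : ℂ) * ⟪b' l, b 0⟫_ℂ := by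
    intro l
    have hsym : ⟪b' l, A'.1 (b 0)⟫_ℂ = ⟪A'.1 (b' l), b 0⟫_ℂ := (A'.2 (b' l) (b 0)).symm
    rw [sub_apply, inner_sub_right, hsym, hb' l, hb 0, inner_smul_left,
      inner_smul_right, Complex.conj_ofReal]
    push_cast
    ring
  have hone : ∑ l, ‖⟪b' l, b 0⟫_ℂ‖ ^ 2 = 1 := by
    rw [b'.sum_sq_norm_inner_right, b.norm_eq_one, one_pow]
  have hsum : ∑ l, ‖⟪b' l, (A'.1 - A.1) (b 0)⟫_ℂ‖ ^ 2 ≤ ‖A'.1 - A.1‖ ^ 2 := by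
    rw [b'.sum_sq_norm_inner_right]
    have := (A'.1 - A.1).le_opNorm (b 0)
    rw [b.norm_eq_one, mul_one] at this
    gcongr
  refine le_trans ?_ hsum
  rw [Fin.sum_univ_succ] at hone ⊢
  have htail : 1 - ‖⟪b' 0, b 0⟫_ℂ‖ ^ 2 = ∑ l : Fin (d + 1), ‖⟪b' l.succ, b 0⟫_ℂ‖ ^ 2 := by
    linarith
  rw [htail, Finset.mul_sum]
  refine le_add_of_nonneg_of_le (by positivity) (Finset.sum_le_sum fun l _ => ?_)
  have hl := energy_zero_add_gap_le (hd := hd) A' (Fin.succ_ne_zero l)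
  rw [hcomp, norm_mul, mul_pow, Complex.norm_real, Real.norm_eq_abs, sq_abs]
  gcongr
  linarith

/-- The two-sided `sin θ` bound for ground states. -/
lemma infidelity_le {A A' : Hamiltonian E}
    {b b' : OrthonormalBasis (Fin (d + 2)) ℂ E} (hb : IsEigenbasis hd A b)
    (hb' : IsEigenbasis hd A' b') {γ lam : ℝ} (hγ : 0 < γ) (hgap : γ ≤ gap hd A)
    (hgap' : γ ≤ gap hd A') (hlam : ‖A'.1 - A.1‖ ≤ lam) :
    1 - ‖⟪b' 0, b 0⟫_ℂ‖ ^ 2 ≤ (lam / γ) ^ 2 := by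
  have key : γ ^ 2 * (1 - ‖⟪b' 0, b 0⟫_ℂ‖ ^ 2) ≤ ‖A'.1 - A.1‖ ^ 2 := by
    -- Both sides are symmetric in the two Hamiltonians, so the lower ground energy may be put
    -- first; the gap is then not reduced by `lam`.
    rcases le_total (energy hd A 0) (energy hd A' 0) with h | h
    · exact gap_sq_mul_infidelity_le_of_energy_le hb hb' hγ.le hgap' h
    · rw [norm_inner_symm, norm_sub_rev]
      exact gap_sq_mul_infidelity_le_of_energy_le hb' hb hγ.le hgap h
  rw [div_pow, le_div_iff₀ (by positivity), mul_comm]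
  exact key.trans (by gcongr)

end

/-- A complex number close to a large positive real one has small argument. -/
lemma exists_polar_of_norm_sub_le {z : ℂ} {c δ ρ : ℝ} (hρ : 0 < ρ) (hz : ‖z - c‖ ≤ δ)
    (hc : ρ ≤ c - δ) :
    ∃ r θ : ℝ, ρ ≤ r ∧ |θ| ≤ δ / ρ ∧ z = (r : ℂ) * Complex.exp (Complex.I * (θ : ℂ)) := by
  have hre : ρ ≤ z.re := by
    have := (abs_le.1 ((Complex.abs_re_le_norm (z - c)).trans hz)).1
    simp at this
    linarith
  have him : |z.im| ≤ δ := by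
    simpa using (Complex.abs_im_le_norm (z - c)).trans hz
  have hpos : 0 < z.re := hρ.trans_le hre
  refine ⟨‖z‖, z.arg, hre.trans (Complex.re_le_norm z), ?_, ?_⟩
  -- In the right half-plane the angle is at most its tangent `|z.im| / z.re`.
  · have habs : |z.arg| < Real.pi / 2 := Complex.abs_arg_lt_pi_div_two_iff.2 (Or.inl hpos)
    calc |z.arg| ≤ Real.tan |z.arg| := Real.le_tan (abs_nonneg _) habs
      _ ≤ |Real.tan z.arg| := by
        rcases abs_choice z.arg with h | h <;> rw [h]
        · exact le_abs_self _
        · rw [Real.tan_neg]; exact neg_le_abs _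
      _ = |z.im| / z.re := by rw [Complex.tan_arg, abs_div, abs_of_pos hpos]
      _ ≤ δ / ρ := by gcongr; exact (abs_nonneg _).trans him
  · rw [mul_comm Complex.I]
    exact (Complex.norm_mul_exp_arg_mul_I z).symm

end Evolution

/-! ### Overlap estimates and the sequences of evolutions -/

section Runs

variable {E : Type*} [NormedAddCommGroup E] [InnerProductSpace ℂ E]

lemma smul_rankOne_mul_smul_rankOne (a c : ℂ) (u v w z : E) :
    (a • InnerProductSpace.rankOne ℂ u v) * (c • InnerProductSpace.rankOne ℂ w z) =
      (a * c * ⟪v, w⟫_ℂ) • InnerProductSpace.rankOne ℂ u z := by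
  ext x
  simp only [mul_apply_eq_comp, smul_apply, InnerProductSpace.rankOne_apply, inner_smul_right,
    smul_smul]
  congr 1
  ring

lemma norm_sub_inner_smul_sq {y v : E} (hy : ‖y‖ = 1) :
    ‖v - ⟪y, v⟫_ℂ • y‖ ^ 2 = ‖v‖ ^ 2 - ‖⟪y, v⟫_ℂ‖ ^ 2 := by
  have h : ⟪v, ⟪y, v⟫_ℂ • y⟫_ℂ = ((‖⟪y, v⟫_ℂ‖ ^ 2 : ℝ) : ℂ) := by
    rw [inner_smul_right, ← inner_conj_symm v y, Complex.mul_conj, Complex.normSq_eq_norm_sq]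
  rw [@norm_sub_sq ℂ, h, norm_smul, hy]
  simp only [RCLike.re_to_complex, Complex.ofReal_re]
  ring

lemma inner_sub_inner_smul_eq_zero {y : E} (hy : ‖y‖ = 1) (v : E) :
    ⟪y, v - ⟪y, v⟫_ℂ • y⟫_ℂ = 0 := by
  simp [inner_self_eq_norm_sq_to_K, hy]

lemma norm_sub_inner_smul_le {y v : E} {x : ℝ} (hy : ‖y‖ = 1) (hv : ‖v‖ = 1) (hx : 0 ≤ x)
    (h : 1 - ‖⟪y, v⟫_ℂ‖ ^ 2 ≤ x ^ 2) : ‖v - ⟪y, v⟫_ℂ • y‖ ≤ x := by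
  refine abs_le_of_sq_le_sq' ?_ hx |>.2
  rwa [norm_sub_inner_smul_sq hy, hv, one_pow]

/-- A vector orthogonal to `y` only sees the part of `v` orthogonal to `y`, of length at most `x`.
This bounds the amplitude for returning to the ground state. -/
lemma norm_inner_le_of_infidelity_le {y v w : E} {x : ℝ} (hy : ‖y‖ = 1) (hv : ‖v‖ = 1)
    (hx : 0 ≤ x) (h : 1 - ‖⟪v, y⟫_ℂ‖ ^ 2 ≤ x ^ 2) (hw : ⟪y, w⟫_ℂ = 0) :
    ‖⟪v, w⟫_ℂ‖ ≤ x * ‖w‖ := by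
  rw [norm_inner_symm] at h
  have heq : ⟪v, w⟫_ℂ = ⟪v - ⟪y, v⟫_ℂ • y, w⟫_ℂ := by
    rw [inner_sub_left, inner_smul_left, hw, mul_zero, sub_zero]
  rw [heq]
  exact (norm_inner_le_norm _ _).trans
    (mul_le_mul_of_nonneg_right (norm_sub_inner_smul_le hy hv hx h) (norm_nonneg _))

lemma inner_eq_norm_of_nonneg {y v : E} (h : 0 ≤ ⟪y, v⟫_ℂ) : ⟪y, v⟫_ℂ = (‖⟪y, v⟫_ℂ‖ : ℂ) :=
  Complex.eq_coe_norm_of_nonneg h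

lemma one_sub_sq_le_norm_inner {y v : E} {x : ℝ} (hy : ‖y‖ = 1) (hv : ‖v‖ = 1)
    (h : 1 - ‖⟪y, v⟫_ℂ‖ ^ 2 ≤ x ^ 2) : 1 - x ^ 2 ≤ ‖⟪y, v⟫_ℂ‖ := by
  have h1 : ‖⟪y, v⟫_ℂ‖ ≤ 1 := by simpa [hy, hv] using norm_inner_le_norm (𝕜 := ℂ) y v
  nlinarith [norm_nonneg ⟪y, v⟫_ℂ]

lemma AccumulatesPhase.exists_eq_add_two_pi {W : E →L[ℂ] E} {x y : E} {φ φ' : ℝ} (hy : y ≠ 0)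
    (h : AccumulatesPhase W x y φ) (h' : AccumulatesPhase W x y φ') :
    ∃ m : ℤ, φ = φ' + 2 * Real.pi * m := by
  obtain ⟨r, hr, hW⟩ := h
  obtain ⟨r', hr', hW'⟩ := h'
  have heq := smul_left_injective ℂ hy (hW.symm.trans hW')
  have hunit : ∀ a : ℝ, ‖Complex.exp (-(Complex.I * (a : ℂ)))‖ = 1 := fun a => by
    rw [show -(Complex.I * (a : ℂ)) = ((-a : ℝ) : ℂ) * Complex.I by push_cast; ring]
    exact Complex.norm_exp_ofReal_mul_I _
  have hrr : r = r' := by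
    simpa [hunit, abs_of_pos hr, abs_of_pos hr'] using congrArg norm heq
  subst hrr
  obtain ⟨m, hm⟩ := Complex.exp_eq_exp_iff_exists_int.1
    (mul_left_cancel₀ (Complex.ofReal_ne_zero.2 hr.ne') heq)
  refine ⟨-m, ?_⟩
  have := congrArg Complex.im hm
  simp at this
  push_cast
  linarith

lemma exists_int_abs_add_two_pi_mul_le_pi (a : ℝ) : ∃ m : ℤ, |a + 2 * Real.pi * m| ≤ Real.pi := by
  refine ⟨-round (a / (2 * Real.pi)), ?_⟩
  have h := abs_sub_round (a / (2 * Real.pi))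
  have h2 : a + 2 * Real.pi * ((-round (a / (2 * Real.pi)) : ℤ) : ℝ) =
      (2 * Real.pi) * (a / (2 * Real.pi) - round (a / (2 * Real.pi))) := by
    have := Real.pi_ne_zero
    push_cast
    field_simp
    ring
  rw [h2, abs_mul, abs_of_pos Real.two_pi_pos]
  nlinarith [Real.pi_pos]

variable [FiniteDimensional ℂ E] {d : ℕ} {hd : Module.finrank ℂ E = d + 2}

/-- The dynamical phase collected by the ground states of the first `n` Hamiltonians. -/
noncomputable def groundPhase (hd : Module.finrank ℂ E = d + 2) (H : ℕ → Hamiltonian E) (t : ℝ) (n : ℕ) : ℝ :=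
  ∑ k ∈ Finset.Icc 1 n, energy hd (H k) 0 * t

lemma groundPhase_succ (H : ℕ → Hamiltonian E) (t : ℝ) (n : ℕ) :
    groundPhase hd H t (n + 1) = groundPhase hd H t n + energy hd (H (n + 1)) 0 * t :=
  Finset.sum_Icc_succ_top (by omega) _

lemma exp_groundPhase_succ (H : ℕ → Hamiltonian E) (t : ℝ) (n : ℕ) :
    Complex.exp (-(Complex.I * (groundPhase hd H t (n + 1) : ℂ))) =
      Complex.exp (-(Complex.I * ((energy hd (H (n + 1)) 0 * t : ℝ) : ℂ))) *
        Complex.exp (-(Complex.I * (groundPhase hd H t n : ℂ))) := by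
  rw [groundPhase_succ, ← Complex.exp_add]
  congr 1
  push_cast
  ring

lemma adiabatic_mul_groundProj (A : Hamiltonian E) (b b' : OrthonormalBasis (Fin (d + 2)) ℂ E)
    (t : ℝ) : adiabatic hd A b b' t * groundProj b =
      Complex.exp (-(Complex.I * ((energy hd A 0 * t : ℝ) : ℂ))) •
        InnerProductSpace.rankOne ℂ (b' 0) (b 0) := by
  ext x
  simp only [adiabatic, groundProj, mul_apply_eq_comp, sum_apply, smul_apply,
    InnerProductSpace.rankOne_apply, inner_smul_right, OrthonormalBasis.inner_eq_ite]
  rw [Finset.sum_eq_single 0]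
  · simp [mul_assoc]
  · intro l _ hl
    simp [hl]
  · simp

lemma evolution_mul_groundProj {A : Hamiltonian E} {b : OrthonormalBasis (Fin (d + 2)) ℂ E}
    (hb : IsEigenbasis hd A b) (t : ℝ) : evolution A t * groundProj b =
      Complex.exp (-(Complex.I * ((energy hd A 0 * t : ℝ) : ℂ))) •
        InnerProductSpace.rankOne ℂ (b 0) (b 0) := by
  ext x
  simp only [groundProj, mul_apply_eq_comp, smul_apply, InnerProductSpace.rankOne_apply, map_smul]
  rw [evolution_apply_of_eigenvector A t (hb 0), smul_comm]

lemma adiabaticSteps_succ (H : ℕ → Hamiltonian E) (b : ℕ → OrthonormalBasis (Fin (d + 2)) ℂ E)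
    (t : ℝ) (n : ℕ) : adiabaticSteps hd H b t (n + 1) =
      Complex.exp (-(Complex.I * (groundPhase hd H t (n + 1) : ℂ))) •
        InnerProductSpace.rankOne ℂ (b (n + 2) 0) (b 1 0) := by
  induction n with
  | zero =>
    rw [adiabaticSteps, adiabaticSteps, mul_one, adiabatic_mul_groundProj]
    simp [groundPhase]
  | succ n ih =>
    rw [adiabaticSteps, ih, adiabatic_mul_groundProj, smul_rankOne_mul_smul_rankOne,
      OrthonormalBasis.inner_eq_one, mul_one, exp_groundPhase_succ H t (n + 1)]

lemma idealRun_succ (H : ℕ → Hamiltonian E) (b : ℕ → OrthonormalBasis (Fin (d + 2)) ℂ E)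
    (t : ℝ) (n : ℕ) : idealRun hd H b t (n + 1) =
      Complex.exp (-(Complex.I * (groundPhase hd H t (n + 1) : ℂ))) •
        InnerProductSpace.rankOne ℂ (b (n + 1) 0) (b 1 0) := by
  rw [idealRun, adiabatic_mul_groundProj]
  cases n with
  | zero => simp [adiabaticSteps, groundPhase]
  | succ n =>
    rw [adiabaticSteps_succ, smul_rankOne_mul_smul_rankOne, OrthonormalBasis.inner_eq_one, mul_one,
      exp_groundPhase_succ H t (n + 1)]

lemma groundRun_succ {H : ℕ → Hamiltonian E} {b : ℕ → OrthonormalBasis (Fin (d + 2)) ℂ E}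
    {M : ℕ} (hb : ∀ k ∈ Finset.Icc 1 M, IsEigenbasis hd (H k) (b k))
    (t : ℝ) (n : ℕ) (hn : n + 1 ≤ M) : groundRun H b t (n + 1) =
      ((∏ k ∈ Finset.Ico 1 (n + 1), ⟪b (k + 1) 0, b k 0⟫_ℂ) *
        Complex.exp (-(Complex.I * (groundPhase hd H t (n + 1) : ℂ)))) •
        InnerProductSpace.rankOne ℂ (b (n + 1) 0) (b 1 0) := by
  induction n with
  | zero =>
    rw [groundRun, groundRun, mul_one, evolution_mul_groundProj (hb 1 (by simp; omega))]
    simp [groundPhase]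
  | succ n ih =>
    rw [groundRun, ih (by omega), evolution_mul_groundProj (hb (n + 2) (by simp; omega)),
      smul_rankOne_mul_smul_rankOne, exp_groundPhase_succ H t (n + 1),
      Finset.prod_Ico_succ_top (show 1 ≤ n + 1 by omega)]
    congr 1
    ring

/-- In each repetition, the amplitude of the histories which are in the ground state is multiplied
by a number close to `1`, up to the dynamical phase; the histories which are not in the ground
state stay orthogonal to it and small. -/
lemma briefRun_polar {H : ℕ → Hamiltonian E} {b : ℕ → OrthonormalBasis (Fin (d + 2)) ℂ E}
    {M : ℕ} (hb : ∀ k ∈ Finset.Icc 1 M, IsEigenbasis hd (H k) (b k))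
    (hphase : ∀ k ∈ Finset.Ico 1 M, 0 ≤ ⟪b (k + 1) 0, b k 0⟫_ℂ) {x : ℝ} (hx : 0 ≤ x)
    (hx3 : 3 * x ≤ 1)
    (hinf : ∀ k ∈ Finset.Ico 1 M, 1 - ‖⟪b (k + 1) 0, b k 0⟫_ℂ‖ ^ 2 ≤ x ^ 2)
    (t : ℝ) (n : ℕ) (hn : n + 1 ≤ M) :
    ∃ r θ : ℝ, 0 < r ∧ |θ| ≤ n * (x ^ 2 / (1 - 2 * x) ^ 2) ∧
      (briefRun H b t (n + 1)).1 (b 1 0) = ((r : ℂ) * Complex.exp (Complex.I * (θ : ℂ)) *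
        Complex.exp (-(Complex.I * (groundPhase hd H t (n + 1) : ℂ)))) • b (n + 1) 0 ∧
      ⟪b (n + 1) 0, (briefRun H b t (n + 1)).2 (b 1 0)⟫_ℂ = 0 ∧
      ‖(briefRun H b t (n + 1)).2 (b 1 0)‖ ≤ x / (1 - 2 * x) * r := by
  have hden : 0 < 1 - 2 * x := by linarith
  induction n with
  | zero =>
    have h1 := hb 1 (by simp; omega)
    have hsnd : (briefRun H b t 1).2 (b 1 0) = 0 := by
      simp [briefRun, groundProj, mul_apply_eq_comp]
    refine ⟨1, 0, one_pos, by simp, ?_, ?_, ?_⟩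
    · simp only [briefRun, zero_add, add_zero, mul_one]
      rw [evolution_mul_groundProj h1]
      simp [groundPhase]
    · rw [zero_add, hsnd, inner_zero_right]
    · rw [zero_add, hsnd, norm_zero]
      positivity
  | succ n ih =>
    obtain ⟨r, θ, hr, hθ, hfst, horth, hsnd⟩ := ih (by omega)
    have hk : n + 1 ∈ Finset.Ico 1 M := by simp; omega
    have hb2 := hb (n + 2) (by simp; omega)
    have hF := hinf _ hk
    have hcos := inner_eq_norm_of_nonneg (hphase _ hk)
    have hcos_ge := one_sub_sq_le_norm_inner ((b (n + 2)).norm_eq_one 0)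
      ((b (n + 1)).norm_eq_one 0) hF
    set y := b (n + 1) 0 with hy
    set y' := b (n + 2) 0 with hy'
    have hy1 : ‖y‖ = 1 := (b (n + 1)).norm_eq_one 0
    have hy1' : ‖y'‖ = 1 := (b (n + 2)).norm_eq_one 0
    set w := (briefRun H b t (n + 1)).2 (b 1 0) with hw
    set c := ‖⟪y', y⟫_ℂ‖ with hc
    set u := Complex.exp (Complex.I * (θ : ℂ)) *
      Complex.exp (-(Complex.I * (groundPhase hd H t (n + 1) : ℂ))) with hu
    have hu1 : ‖u‖ = 1 := by
      rw [hu, ← Complex.exp_add, show Complex.I * (θ : ℂ) +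
        -(Complex.I * (groundPhase hd H t (n + 1) : ℂ)) =
          ((θ - groundPhase hd H t (n + 1) : ℝ) : ℂ) * Complex.I by push_cast; ring]
      exact Complex.norm_exp_ofReal_mul_I _
    have hu0 : u ≠ 0 := norm_ne_zero_iff.1 (by rw [hu1]; exact one_ne_zero)
    rw [mul_assoc, ← hu] at hfst
    -- With the old phase `u` divided out, the new ground amplitude is the positive number `c * r`
    -- plus the contribution of the returning histories.
    have hdev : ‖(((c * r : ℝ) : ℂ) + ⟪y', w⟫_ℂ * u⁻¹) - ((c * r : ℝ) : ℂ)‖ ≤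
        x ^ 2 / (1 - 2 * x) * r := by
      rw [add_sub_cancel_left, norm_mul, norm_inv, hu1, inv_one, mul_one]
      calc ‖⟪y', w⟫_ℂ‖ ≤ x * ‖w‖ := norm_inner_le_of_infidelity_le hy1 hy1' hx hF horth
        _ ≤ x * (x / (1 - 2 * x) * r) := by gcongr
        _ = x ^ 2 / (1 - 2 * x) * r := by ring
    -- The amplitude shrinks by at most the factor `1 - 2 * x`. This follows from `c ≥ 1 - x ^ 2`,
    -- and is where `3 * x ≤ 1` enters.
    have hratio : 1 - 2 * x ≤ c - x ^ 2 / (1 - 2 * x) := by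
      have : x ^ 2 / (1 - 2 * x) ≤ 2 * x - x ^ 2 := by
        rw [div_le_iff₀ hden]
        nlinarith [mul_nonneg hx (by linarith : 0 ≤ 1 - 3 * x), pow_nonneg hx 3]
      linarith
    obtain ⟨r', θ', hr', hθ', hz⟩ := exists_polar_of_norm_sub_le
      (ρ := (1 - 2 * x) * r) (by positivity) hdev (by nlinarith)
    have hr'0 : 0 < r' := lt_of_lt_of_le (by positivity) hr'
    refine ⟨r', θ + θ', hr'0, ?_, ?_, ?_, ?_⟩
    · refine (abs_add_le _ _).trans ?_
      have : x ^ 2 / (1 - 2 * x) * r / ((1 - 2 * x) * r) = x ^ 2 / (1 - 2 * x) ^ 2 := by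
        field_simp
      rw [this] at hθ'
      push_cast
      linarith
    · have hz' : (r : ℂ) * u * (c : ℂ) + ⟪y', w⟫_ℂ =
          (r' : ℂ) * Complex.exp (Complex.I * (θ' : ℂ)) * u := by
        rw [← hz]
        field_simp
        push_cast
        ring
      rw [briefRun, evolution_mul_groundProj hb2, exp_groundPhase_succ H t (n + 1)]
      simp only [mul_apply_eq_comp, smul_apply, add_apply, InnerProductSpace.rankOne_apply]
      rw [hfst, ← hw, ← hy', inner_add_right, inner_smul_right, hcos, hz', smul_smul, hu]
      congr 1
      push_cast
      rw [mul_add, Complex.exp_add]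
      ring
    · rw [briefRun]
      simp only [mul_apply_eq_comp]
      refine inner_evolution_eq_zero_of_eigenvector _ _ (hb2 0) ?_
      exact inner_sub_inner_smul_eq_zero hy1' _
    · rw [briefRun]
      simp only [mul_apply_eq_comp]
      rw [norm_evolution, hfst, map_smul, norm_smul, norm_mul, hu1, mul_one, Complex.norm_real,
        Real.norm_of_nonneg hr.le]
      have hres : ‖(1 - groundProj (b (n + 2))) y‖ ≤ x :=
        norm_sub_inner_smul_le hy1' hy1 hx hF
      -- Only histories in the ground state may leave it, so the excited part is created afresh from
      -- `r` and does not build up.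
      calc r * ‖(1 - groundProj (b (n + 2))) y‖ ≤ r * x := by gcongr
        _ = x / (1 - 2 * x) * ((1 - 2 * x) * r) := by
          rw [← mul_assoc, div_mul_cancel₀ _ hden.ne', mul_comm]
        _ ≤ x / (1 - 2 * x) * r' := by gcongr

end Runs

/-! ### Scalar inequalities -/

lemma pow_le_prod_Ico {f : ℕ → ℝ} {a : ℝ} {M : ℕ} (ha : 0 ≤ a)
    (h : ∀ k ∈ Finset.Ico 1 M, a ≤ f k) : a ^ (M - 1) ≤ ∏ k ∈ Finset.Ico 1 M, f k := by
  calc a ^ (M - 1) = ∏ _k ∈ Finset.Ico 1 M, a := by simp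
    _ ≤ ∏ k ∈ Finset.Ico 1 M, f k := Finset.prod_le_prod (fun _ _ => ha) h

lemma one_sub_lt_pow_of_lt_sqrt {x ε : ℝ} {M : ℕ} (hM : 1 < M) (hx : 0 ≤ x) (hε : ε < 1)
    (h : x < Real.sqrt (1 - Real.exp (Real.log (1 - ε) / ((M : ℝ) - 1)))) :
    x ^ 2 < 1 ∧ 1 - ε ≤ (1 - x ^ 2) ^ (M - 1) := by
  rw [Real.lt_sqrt hx] at h
  have hpos := Real.exp_pos (Real.log (1 - ε) / ((M : ℝ) - 1))
  refine ⟨by linarith, ?_⟩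
  have hM1 : (M : ℝ) - 1 ≠ 0 := by
    have : (1 : ℝ) < M := by exact_mod_cast hM
    linarith
  calc 1 - ε = Real.exp (Real.log (1 - ε) / ((M : ℝ) - 1)) ^ (M - 1) := by
        rw [← Real.exp_nat_mul, Nat.cast_sub hM.le, Nat.cast_one, mul_div_cancel₀ _ hM1,
          Real.exp_log (by linarith)]
    _ ≤ (1 - x ^ 2) ^ (M - 1) := by gcongr; linarith

lemma sq_div_sub_two_mul_sq {γ lam : ℝ} (hγ : γ ≠ 0) (M : ℝ) :
    2 * M * lam ^ 2 / (γ - 2 * lam) ^ 2 =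
      2 * M * ((lam / γ) ^ 2 / (1 - 2 * (lam / γ)) ^ 2) := by
  have : γ - 2 * lam = γ * (1 - 2 * (lam / γ)) := by field_simp
  rw [this, mul_pow, div_pow, div_div, mul_div_assoc]

lemma sq_le_two_mul_sq_div {x : ℝ} (hx : 0 ≤ x) (hx1 : x ≤ 1) (hx2 : 1 - 2 * x ≠ 0) :
    x ^ 2 ≤ x ^ 2 / (1 - 2 * x) ^ 2 := by
  rw [le_div_iff₀ (by positivity)]
  have : (1 - 2 * x) ^ 2 ≤ 1 := by nlinarith
  nlinarith [sq_nonneg x]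

/-- On `1/3 < x ≤ 1` one has `|1 - 2 * x| ≤ x`. -/
lemma one_le_sq_div {x : ℝ} (hx : 1 < 3 * x) (hx1 : x ≤ 1) (hx2 : 1 - 2 * x ≠ 0) :
    1 ≤ x ^ 2 / (1 - 2 * x) ^ 2 := by
  rw [le_div_iff₀ (by positivity)]
  nlinarith

end RandomizedPhaseEstimation

/-! ### The main theorem -/

open RandomizedPhaseEstimation in
theorem theorem1 {E : Type*} [NormedAddCommGroup E] [InnerProductSpace ℂ E]
    [FiniteDimensional ℂ E] {d : ℕ} (hd : Module.finrank ℂ E = d + 2)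
    (M : ℕ) (hM : 1 < M) (H : ℕ → Hamiltonian E)
    (ψ : ℕ → OrthonormalBasis (Fin (d + 2)) ℂ E)
    (hψ : ∀ k ∈ Finset.Icc 1 M, IsEigenbasis hd (H k) (ψ k))
    (hphase : ∀ k ∈ Finset.Ico 1 M, 0 ≤ ⟪ψ (k + 1) 0, ψ k 0⟫_ℂ)
    (Δt γ lam ε : ℝ)
    (hγ : IsLeast {g : ℝ | ∃ k ∈ Finset.Icc 1 M, g = gap hd (H k)} γ) (hγ_pos : 0 < γ)
    (hlam : IsGreatest {x : ℝ | ∃ k ∈ Finset.Ico 1 M, x = ‖(H (k + 1)).1 - (H k).1‖} lam)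
    (hε_pos : 0 < ε) (hε_lt : ε < 1)
    (hsmall : lam / γ < Real.sqrt (1 - Real.exp (Real.log (1 - ε) / ((M : ℝ) - 1)))) :
    failureProb H ψ Δt M ≤ ε ∧
    AccumulatesPhase (idealRun hd H ψ Δt M) (ψ 1 0) (ψ M 0)
      (∑ k ∈ Finset.Icc 1 M, energy hd (H k) 0 * Δt) ∧
    AccumulatesPhase (groundRun H ψ Δt M) (ψ 1 0) (ψ M 0)
      (∑ k ∈ Finset.Icc 1 M, energy hd (H k) 0 * Δt) ∧
    (γ ≠ 2 * lam →
      ‖groundRun H ψ Δt M - idealRun hd H ψ Δt M‖ ≤ 2 * M * lam ^ 2 / (γ - 2 * lam) ^ 2 ∧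
      (2 * M * lam ^ 2 / (γ - 2 * lam) ^ 2 < Real.pi →
        ∃ φest : ℝ, AccumulatesPhase (briefRun H ψ Δt M).1 (ψ 1 0) (ψ M 0) φest) ∧
      ∀ φest φtrue : ℝ,
        AccumulatesPhase (briefRun H ψ Δt M).1 (ψ 1 0) (ψ M 0) φest →
        AccumulatesPhase (idealRun hd H ψ Δt M) (ψ 1 0) (ψ M 0) φtrue →
        ∃ m : ℤ, |φest - φtrue + 2 * Real.pi * m| ≤ 2 * M * lam ^ 2 / (γ - 2 * lam) ^ 2) := by
  obtain ⟨n, rfl⟩ : ∃ n, M = n + 1 := ⟨M - 1, by omega⟩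
  have hlam0 : 0 ≤ lam := by
    obtain ⟨k, _, rfl⟩ := hlam.1
    exact norm_nonneg _
  have hx : 0 ≤ lam / γ := by positivity
  have hinf : ∀ k ∈ Finset.Ico 1 (n + 1),
      1 - ‖⟪ψ (k + 1) 0, ψ k 0⟫_ℂ‖ ^ 2 ≤ (lam / γ) ^ 2 := by
    intro k hk
    have hk0 : k ∈ Finset.Icc 1 (n + 1) := by simp at hk ⊢; omega
    have hk1 : k + 1 ∈ Finset.Icc 1 (n + 1) := by simp at hk ⊢; omega
    exact infidelity_le (hψ k hk0) (hψ _ hk1) hγ_pos (hγ.2 ⟨k, hk0, rfl⟩) (hγ.2 ⟨_, hk1, rfl⟩)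
      (hlam.2 ⟨k, hk, rfl⟩)
  obtain ⟨hx1, hpow⟩ := one_sub_lt_pow_of_lt_sqrt hM hx hε_lt hsmall
  rw [sq_div_sub_two_mul_sq hγ_pos.ne']
  have hγlam : γ ≠ 2 * lam → 1 - 2 * (lam / γ) ≠ 0 := by
    intro h h'
    field_simp at h'
    exact h (by linarith)
  generalize lam / γ = x at hx hinf hx1 hpow hγlam ⊢
  have hxle : x ≤ 1 := by nlinarith
  have hcos : ∀ k ∈ Finset.Ico 1 (n + 1), 1 - x ^ 2 ≤ ‖⟪ψ (k + 1) 0, ψ k 0⟫_ℂ‖ := fun k hk =>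
    one_sub_sq_le_norm_inner ((ψ _).norm_eq_one 0) ((ψ _).norm_eq_one 0) (hinf k hk)
  set c : ℝ := ∏ k ∈ Finset.Ico 1 (n + 1), ‖⟪ψ (k + 1) 0, ψ k 0⟫_ℂ‖ with hc
  have hc_eq : ∏ k ∈ Finset.Ico 1 (n + 1), ⟪ψ (k + 1) 0, ψ k 0⟫_ℂ = (c : ℂ) := by
    rw [hc, Complex.ofReal_prod]
    exact Finset.prod_congr rfl fun k hk => inner_eq_norm_of_nonneg (hphase k hk)
  have hc_ge : (1 - x ^ 2) ^ n ≤ c := pow_le_prod_Ico (M := n + 1) (by linarith) hcos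
  -- Applying the infidelity bound to the squared overlaps avoids the exponent `2 * n` that squaring
  -- `hc_ge` would give.
  have hc_sq : (1 - x ^ 2) ^ n ≤ c ^ 2 := by
    rw [hc, ← Finset.prod_pow]
    exact pow_le_prod_Ico (M := n + 1) (by linarith) fun k hk => by linarith [hinf k hk]
  have hc_pos : 0 < c := lt_of_lt_of_le (pow_pos (by linarith) n) hc_ge
  have hc_le : c ≤ 1 := Finset.prod_le_one (fun _ _ => norm_nonneg _) fun k _ => by
    simpa using norm_inner_le_norm (𝕜 := ℂ) (ψ (k + 1) 0) (ψ k 0)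
  have hground := groundRun_succ hψ Δt n le_rfl
  rw [hc_eq] at hground
  have hideal := idealRun_succ (hd := hd) H ψ Δt n
  have hunit : ‖Complex.exp (-(Complex.I * (groundPhase hd H Δt (n + 1) : ℂ)))‖ = 1 := by
    rw [← mul_neg, ← Complex.ofReal_neg]
    exact Complex.norm_exp_I_mul_ofReal _
  have hideal_phase : AccumulatesPhase (idealRun hd H ψ Δt (n + 1)) (ψ 1 0) (ψ (n + 1) 0)
      (groundPhase hd H Δt (n + 1)) := ⟨1, one_pos, by
    rw [hideal, smul_apply, InnerProductSpace.rankOne_apply, OrthonormalBasis.inner_eq_one,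
      one_smul, Complex.ofReal_one, one_mul]⟩
  refine ⟨?_, hideal_phase, ⟨c, hc_pos, ?_⟩, fun hne => ?_⟩
  · rw [failureProb, hground, smul_apply, InnerProductSpace.rankOne_apply,
      OrthonormalBasis.inner_eq_one, one_smul, norm_smul, norm_mul, hunit, mul_one,
      OrthonormalBasis.norm_eq_one, mul_one, Complex.norm_real, Real.norm_eq_abs, sq_abs]
    rw [Nat.add_sub_cancel] at hpow
    linarith
  · rw [hground, smul_apply, InnerProductSpace.rankOne_apply, OrthonormalBasis.inner_eq_one,
      one_smul]
    rfl
  have hx2 := hγlam hne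
  have hB : 0 ≤ x ^ 2 / (1 - 2 * x) ^ 2 := by positivity
  have hphase_error : 3 * x ≤ 1 → ∃ θ : ℝ,
      |θ| ≤ 2 * ((n + 1 : ℕ) : ℝ) * (x ^ 2 / (1 - 2 * x) ^ 2) ∧
      AccumulatesPhase (briefRun H ψ Δt (n + 1)).1 (ψ 1 0) (ψ (n + 1) 0)
        (groundPhase hd H Δt (n + 1) - θ) := by
    intro hx3
    obtain ⟨r, θ, hr, hθ, hW, -⟩ := briefRun_polar hψ hphase hx hx3 hinf Δt n le_rfl
    refine ⟨θ, hθ.trans ?_, r, hr, ?_⟩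
    · gcongr
      push_cast
      linarith [(Nat.cast_nonneg n : (0 : ℝ) ≤ n)]
    · rw [hW, mul_assoc, ← Complex.exp_add]
      congr 3
      push_cast
      ring
  -- At least two Hamiltonians make the right side at least `4`.
  have hlarge : 1 < 3 * x → Real.pi ≤ 2 * ((n + 1 : ℕ) : ℝ) * (x ^ 2 / (1 - 2 * x) ^ 2) := by
    intro hx3
    have hM2 : (2 : ℝ) ≤ ((n + 1 : ℕ) : ℝ) := by exact_mod_cast hM
    nlinarith [Real.pi_le_four, one_le_sq_div hx3 hxle hx2]
  refine ⟨?_, fun hlt => ?_, fun φest φtrue hest htrue => ?_⟩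
  · have hbern : 1 - n * x ^ 2 ≤ (1 - x ^ 2) ^ n := by
      simpa [sub_eq_add_neg] using one_add_mul_le_pow (a := -x ^ 2) (by linarith) n
    rw [hground, hideal, ← sub_smul, ← sub_one_mul, norm_smul, norm_mul, hunit,
      InnerProductSpace.norm_rankOne, OrthonormalBasis.norm_eq_one, OrthonormalBasis.norm_eq_one,
      ← Complex.ofReal_one, ← Complex.ofReal_sub, Complex.norm_real, Real.norm_eq_abs,
      abs_sub_comm, abs_of_nonneg (by linarith)]
    calc (1 - c) * 1 * (1 * 1) ≤ n * x ^ 2 := by linarith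
      _ ≤ 2 * ((n + 1 : ℕ) : ℝ) * (x ^ 2 / (1 - 2 * x) ^ 2) := by
        gcongr
        · push_cast
          linarith [(Nat.cast_nonneg n : (0 : ℝ) ≤ n)]
        · exact sq_le_two_mul_sq_div hx hxle hx2
  · rcases le_or_gt (3 * x) 1 with hx3 | hx3
    · obtain ⟨θ, -, h⟩ := hphase_error hx3
      exact ⟨_, h⟩
    · exact absurd hlt (not_lt.2 (hlarge hx3))
  · rcases le_or_gt (3 * x) 1 with hx3 | hx3
    · obtain ⟨θ, hθ, h⟩ := hphase_error hx3
      have hne0 : ψ (n + 1) 0 ≠ 0 := (ψ (n + 1)).orthonormal.ne_zero 0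
      obtain ⟨m, hm⟩ := hest.exists_eq_add_two_pi hne0 h
      obtain ⟨m', hm'⟩ := htrue.exists_eq_add_two_pi hne0 hideal_phase
      refine ⟨m' - m, ?_⟩
      rw [hm, hm', ← abs_neg]
      convert hθ using 2
      push_cast
      ring
    -- Any two phases are within `π` of each other modulo `2π`.
    · obtain ⟨m, hm⟩ := exists_int_abs_add_two_pi_mul_le_pi (φest - φtrue)
      exact ⟨m, hm.trans (hlarge hx3)⟩
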